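/- Let $\mu_1,\mu_2\in\mathbb R^d$ and let $\Sigma\in\mathbb R^{d\times d}$ be symmetric positive semidefinite. Let $(x,y)$ be drawn from the balanced Gaussian mixture $P(y=1)=P(y=-1)=\tfrac12$, $x\mid y=1\sim\mathcal N(\mu_1,\Sigma)$, $x\mid y=-1\sim\mathcal N(\mu_2,\Sigma)$. Let $\Sigma=F\Lambda F^T$ be the thin eigendecomposition: $F\in\mathbb R^{d\times r}$, $F^TF=I_r$, and $\Lambda$ is the $r\times r$ diagonal matrix of the nonzero eigenvalues. Put $\tilde\mu=F^T\frac{\mu_1-\mu_2}{2}$, let $0\le\epsilon<\|\tilde\mu\|_2$, and write $\|v\|_\Lambda=\sqrt{v^T\Lambda v}$; let $\Phi$ be the standard normal distribution function. A classifier is a measurable map $f:\mathbb R^d\to\{-1,0,1\}$ (the value $0$ is there for $\operatorname{sign}(0)$ and is always counted as an error). It is called $\epsilon$-robust Bayes optimal in a class of classifiers if it minimizes $P(\exists\,\delta:\ \|\delta\|_2\le\epsilon,\ f(x+\delta)\ne y)$ over that class, and its standard accuracy is $P(f(x)=y)$. Then the problem of minimizing $(\tilde\mu-z)^T\Lambda^{-1}(\tilde\mu-z)$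 over $\|z\|_2\le\epsilon$ has a unique solution $z_\Lambda(\tilde\mu)$, the vector $w=\Lambda^{-1}(\tilde\mu-z_\Lambda(\tilde\mu))$ satisfies $\|w\|_\Lambda>0$, and the following hold. (a) If $\mu_1-\mu_2$ lies in the range of $\Sigma$ (for instance, if $\Sigma$ is invertible), then the classifier $\hat y^*(x)=\operatorname{sign}\{(x-\frac{\mu_1+\mu_2}{2})^TFw\}$ is $\epsilon$-robust Bayes optimal among all classifiers, and every classifier that is $\epsilon$-robust Bayes optimal among all classifiers has standard accuracy $$\Phi\!\left(\frac{\tilde\mu^T\Lambda^{-1}(\tilde\mu-z_\Lambda(\tilde\mu))}{\|\Lambda^{-1}(\tilde\mu-z_\Lambda(\tilde\mu))\|_\Lambda}\right).$$ (b) For every $\Sigma$ as above, the same two assertions hold with "all classifiers" replaced by the classifiers that depend on $x$ only through $F^Tx$. -/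

import Mathlib

open MeasureTheory ProbabilityTheory
open scoped Matrix ENNReal

/-- `SignType = {-1, 0, 1}` carries the discrete σ-algebra. -/
instance instMeasurableSpaceSignType : MeasurableSpace SignType := ⊤

namespace RobustGaussian

noncomputable section

/-- The law of `(x, y)` on `ℝᵈ × {-1, 0, 1}` for the balanced two-class Gaussian model:
`P(y = 1) = P(y = -1) = 1/2`, `x | y = 1 ∼ N(μ₁, S)` and `x | y = -1 ∼ N(μ₂, S)`. -/
def gaussianMixture {d : ℕ} (μ₁ μ₂ : EuclideanSpace ℝ (Fin d)) (S : Matrix (Fin d) (Fin d) ℝ) :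
    Measure (EuclideanSpace ℝ (Fin d) × SignType) :=
  (1 / 2 : ℝ≥0∞) • (multivariateGaussian μ₁ S).map (fun x => (x, (1 : SignType))) +
    (1 / 2 : ℝ≥0∞) • (multivariateGaussian μ₂ S).map (fun x => (x, (-1 : SignType)))

/-- Standard accuracy `P(f(x) = y)`. -/
def standardAccuracy {d : ℕ} (P : Measure (EuclideanSpace ℝ (Fin d) × SignType))
    (f : EuclideanSpace ℝ (Fin d) → SignType) : ℝ :=
  P.real {p | f p.1 = p.2}

/-- Robust classification error `P(∃ δ, ‖δ‖₂ ≤ ε and f(x + δ) ≠ y)`. (The event is an analytic set,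
hence measurable for the completion of `P`, and `P` of it is its outer measure.) -/
def robustError {d : ℕ} (ε : ℝ) (P : Measure (EuclideanSpace ℝ (Fin d) × SignType))
    (f : EuclideanSpace ℝ (Fin d) → SignType) : ℝ≥0∞ :=
  P {p | ∃ δ : EuclideanSpace ℝ (Fin d), ‖δ‖ ≤ ε ∧ f (p.1 + δ) ≠ p.2}

/-- `f` is `ε`-robust Bayes optimal in the class `C`: it minimizes the robust error over `C`. -/
def IsRobustBayesOptimal {d : ℕ} (C : Set (EuclideanSpace ℝ (Fin d) → SignType)) (ε : ℝ)
    (P : Measure (EuclideanSpace ℝ (Fin d) × SignType))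
    (f : EuclideanSpace ℝ (Fin d) → SignType) : Prop :=
  f ∈ C ∧ ∀ g ∈ C, robustError ε P f ≤ robustError ε P g

/-- All classifiers on `ℝᵈ`: measurable maps to `{-1, 0, 1}`. The value `0` is allowed because
the sign function takes it; as a prediction it is always wrong, and replacing it by `1` never
increases the robust error, so minimizing over `{-1, 1}`-valued maps gives the same minimum. -/
def allClassifiers (d : ℕ) : Set (EuclideanSpace ℝ (Fin d) → SignType) :=
  {f | Measurable f}

/-- The vector `Fᵀ x ∈ ℝʳ`. -/
def reduce {d r : ℕ} (F : Matrix (Fin d) (Fin r) ℝ) (x : EuclideanSpace ℝ (Fin d)) :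
    EuclideanSpace ℝ (Fin r) :=
  WithLp.toLp 2 (Fᵀ *ᵥ x.ofLp)

/-- The classifiers on `ℝᵈ` that depend on `x` only through `Fᵀ x`. -/
def reducedClassifiers {d r : ℕ} (F : Matrix (Fin d) (Fin r) ℝ) :
    Set (EuclideanSpace ℝ (Fin d) → SignType) :=
  {f | ∃ h : EuclideanSpace ℝ (Fin r) → SignType, Measurable h ∧ f = fun x => h (reduce F x)}

/-- `S = F Λ Fᵀ` is the economy-size (thin) eigendecomposition, `Λ = diag(lam)`: the columns of `F`
are orthonormal and only the nonzero eigenvalues are kept. -/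
structure IsThinEigendecomposition {d r : ℕ} (S : Matrix (Fin d) (Fin d) ℝ)
    (F : Matrix (Fin d) (Fin r) ℝ) (lam : Fin r → ℝ) : Prop where
  orthonormal : Fᵀ * F = 1
  ne_zero : ∀ i, lam i ≠ 0
  eq : F * Matrix.diagonal lam * Fᵀ = S

/-- `μ̃ = Fᵀ (μ₁ - μ₂) / 2`. -/
def muTilde {d r : ℕ} (F : Matrix (Fin d) (Fin r) ℝ) (μ₁ μ₂ : EuclideanSpace ℝ (Fin d)) :
    EuclideanSpace ℝ (Fin r) :=
  reduce F ((1 / 2 : ℝ) • (μ₁ - μ₂))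

/-- `Λ⁻¹ v`, for `Λ = diag(lam)`. -/
def invMul {r : ℕ} (lam : Fin r → ℝ) (v : EuclideanSpace ℝ (Fin r)) : EuclideanSpace ℝ (Fin r) :=
  WithLp.toLp 2 ((Matrix.diagonal lam)⁻¹ *ᵥ v.ofLp)

/-- `‖v‖_Λ = √(vᵀ Λ v)`, for `Λ = diag(lam)`. -/
def lamNorm {r : ℕ} (lam : Fin r → ℝ) (v : EuclideanSpace ℝ (Fin r)) : ℝ :=
  Real.sqrt (v.ofLp ⬝ᵥ (Matrix.diagonal lam *ᵥ v.ofLp))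

/-- `z` minimizes `(m - z)ᵀ Λ⁻¹ (m - z)` subject to `‖z‖₂ ≤ ε`. -/
def IsProjSolution {r : ℕ} (lam : Fin r → ℝ) (ε : ℝ) (m z : EuclideanSpace ℝ (Fin r)) : Prop :=
  ‖z‖ ≤ ε ∧ ∀ z' : EuclideanSpace ℝ (Fin r), ‖z'‖ ≤ ε →
    inner ℝ (m - z) (invMul lam (m - z)) ≤ inner ℝ (m - z') (invMul lam (m - z'))

/-- The linear classifier `x ↦ sign((x - (μ₁ + μ₂)/2)ᵀ F w)`. -/
def linearClassifier {d r : ℕ} (F : Matrix (Fin d) (Fin r) ℝ) (μ₁ μ₂ : EuclideanSpace ℝ (Fin d))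
    (w : EuclideanSpace ℝ (Fin r)) (x : EuclideanSpace ℝ (Fin d)) : SignType :=
  SignType.sign (inner ℝ (x - (1 / 2 : ℝ) • (μ₁ + μ₂)) (WithLp.toLp 2 (F *ᵥ w.ofLp)))

/-- The standard normal distribution function `Φ`. -/
def Phi (t : ℝ) : ℝ := cdf (gaussianReal 0 1) t

end

end RobustGaussian

namespace RobustGaussian

/-! The proof is a saddle-point argument in whitened coordinates. Put `B = F Λ^(1/2)`, so that `S =
B Bᵀ` and each class is its mean plus `B u` with `u` standard Gaussian. Choose `b`, `c` with `B b =
F μ̃`, `B c = F z`.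

Lower bound (`translateError_le_robustError`): since `‖B c‖ = ‖z‖ ≤ ε`, the adversary may always
move the two classes by `∓B c`. The robust error is therefore at least the plain error of separating
Gaussians centred at `±(b - c)`, which `sign ⟪b - c, u⟫` minimizes.

Upper bound (`robustError_sign_le`): the first-order condition for `z` gives `ε ‖w‖ ≤ ⟪z, w⟫`, so
`z` is the worst perturbation against the linear classifier with normal `F w`, and the lower bound
is attained.

Any robust optimal `f` thus makes `u ↦ f (m + B u)`, with `m` the midpoint of the means, a Bayes
classifier of the shifted problem. Such a classifier is a.e. unique, and this determines the
accuracy, namely the probability of `⟪b - c, u⟫ < ⟪b - c, b⟫`. Parts (a) and (b) differ only in the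
reason for `SeesMeans`. -/

/-! ### Standard Gaussian: projections, translates, affine images -/

theorem stdGaussian_map_inner {ι : Type*} [Fintype ι] (θ : EuclideanSpace ℝ ι) :
    (stdGaussian (EuclideanSpace ℝ ι)).map (fun x => inner ℝ θ x) =
      gaussianReal 0 (‖θ‖₊ ^ 2) := by
  have h := IsGaussian.map_eq_gaussianReal (μ := stdGaussian (EuclideanSpace ℝ ι)) (innerSL ℝ θ)
  rw [integral_strongDual_stdGaussian, variance_dual_stdGaussian, innerSL_apply_norm] at h
  have h2 : (‖θ‖ ^ 2).toNNReal = ‖θ‖₊ ^ 2 := by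
    rw [Real.toNNReal_pow (norm_nonneg _), norm_toNNReal]
  rw [h2] at h
  exact h

theorem stdGaussian_inner_eq_zero {ι : Type*} [Fintype ι] {θ : EuclideanSpace ℝ ι} (hθ : θ ≠ 0) :
    ∀ᵐ x ∂stdGaussian (EuclideanSpace ℝ ι), inner ℝ θ x ≠ 0 := by
  have hv : ‖θ‖₊ ^ 2 ≠ 0 := pow_ne_zero _ (by simpa using hθ)
  have := nullSingletonClass_gaussianReal (μ := 0) hv
  have h : (gaussianReal 0 (‖θ‖₊ ^ 2)) {0} = 0 := measure_singleton 0
  rw [← stdGaussian_map_inner, Measure.map_apply (by fun_prop) (measurableSet_singleton 0)] at h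
  exact measure_eq_zero_iff_ae_notMem.1 h

/-- The Cameron-Martin formula: translating the standard Gaussian by `θ` multiplies it by the
density `exp (⟪θ, x⟫ - ‖θ‖² / 2)`. -/
theorem stdGaussian_map_add {ι : Type*} [Fintype ι] (θ : EuclideanSpace ℝ ι) :
    (stdGaussian (EuclideanSpace ℝ ι)).map (fun x => x + θ) =
      (stdGaussian (EuclideanSpace ℝ ι)).withDensity
        (fun x => ENNReal.ofReal (Real.exp (inner ℝ θ x - ‖θ‖ ^ 2 / 2))) := by
  have hint : Integrable (fun x => Real.exp (inner ℝ θ x - ‖θ‖ ^ 2 / 2))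
      (stdGaussian (EuclideanSpace ℝ ι)) := by
    have h1 := integrable_exp_mul_gaussianReal (μ := 0) (v := ‖θ‖₊ ^ 2) 1
    rw [← stdGaussian_map_inner,
      integrable_map_measure (by fun_prop) (by fun_prop)] at h1
    simp_rw [Real.exp_sub]
    refine Integrable.div_const ?_ _
    simpa [Function.comp_def] using h1
  have : IsFiniteMeasure ((stdGaussian (EuclideanSpace ℝ ι)).withDensity
      (fun x => ENNReal.ofReal (Real.exp (inner ℝ θ x - ‖θ‖ ^ 2 / 2)))) :=
    isFiniteMeasure_withDensity_ofReal hint.2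
  apply Measure.ext_of_charFun
  ext t
  rw [charFun_map_add_const, charFun_stdGaussian, charFun_apply,
    integral_withDensity_eq_integral_toReal_smul (by fun_prop) (by simp)]
  -- The integrand factors over coordinates, leaving one-dimensional complex moment generating
  -- functions at `θ i + t i * I`.
  have hx : ∀ x : EuclideanSpace ℝ ι,
      (ENNReal.ofReal (Real.exp (inner ℝ θ x - ‖θ‖ ^ 2 / 2))).toReal •
        Complex.exp (inner ℝ x t * Complex.I) =
      Complex.exp (-(‖θ‖ ^ 2 / 2)) * ∏ i, Complex.exp ((θ i + t i * Complex.I) * x i) := by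
    intro x
    rw [ENNReal.toReal_ofReal (Real.exp_pos _).le, Complex.real_smul, Complex.ofReal_exp,
      ← Complex.exp_add, ← Complex.exp_sum, ← Complex.exp_add]
    congr 1
    simp only [PiLp.inner_apply, RCLike.inner_apply, conj_trivial]
    push_cast
    rw [Finset.sum_mul, add_comm, ← sub_eq_zero]
    have : ∑ i, ((θ i : ℂ) + t i * Complex.I) * x i =
        ∑ i, (x i : ℂ) * θ i + ∑ i, (t i : ℂ) * x i * Complex.I := by
      rw [← Finset.sum_add_distrib]
      exact Finset.sum_congr rfl fun i _ => by ring
    rw [this]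
    ring
  simp_rw [hx]
  rw [integral_const_mul, ← map_pi_eq_stdGaussian,
    integral_map (by fun_prop) (by fun_prop)]
  change _ = _ * ∫ x : ι → ℝ, ∏ i, Complex.exp ((θ i + t i * Complex.I) * x i) ∂_
  rw [integral_fintype_prod_eq_prod (f := fun i (x : ℝ) =>
    Complex.exp ((θ i + t i * Complex.I) * x))]
  have h1 : ∀ z : ℂ, ∫ x : ℝ, Complex.exp (z * x) ∂gaussianReal 0 1 = Complex.exp (z ^ 2 / 2) := by
    intro z
    have := complexMGF_id_gaussianReal (μ := 0) (v := 1) z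
    simpa [complexMGF] using this
  simp_rw [h1]
  rw [← Complex.exp_sum, ← Complex.exp_add, ← Complex.exp_add]
  congr 1
  rw [← Complex.ofReal_pow, ← Complex.ofReal_pow, EuclideanSpace.real_norm_sq_eq,
    EuclideanSpace.real_norm_sq_eq]
  simp only [PiLp.inner_apply, RCLike.inner_apply, conj_trivial]
  push_cast
  have : ∀ i, ((θ i : ℂ) + t i * Complex.I) ^ 2 / 2 =
      (θ i) ^ 2 / 2 + (t i * θ i) * Complex.I - (t i) ^ 2 / 2 := by
    intro i
    linear_combination (t i) ^ 2 / 2 * Complex.I_sq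
  simp_rw [this, Finset.sum_sub_distrib, Finset.sum_add_distrib, ← Finset.sum_div,
    ← Finset.sum_mul]
  ring

/-- Translates of the standard Gaussian are absolutely continuous. -/
theorem ae_stdGaussian_comp_add {ι : Type*} [Fintype ι] (θ : EuclideanSpace ℝ ι)
    {p : EuclideanSpace ℝ ι → Prop} (h : ∀ᵐ x ∂stdGaussian (EuclideanSpace ℝ ι), p x) :
    ∀ᵐ x ∂stdGaussian (EuclideanSpace ℝ ι), p (x + θ) := by
  refine ae_of_ae_map (f := fun x => x + θ) (by fun_prop) ?_
  rw [stdGaussian_map_add]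
  exact withDensity_absolutelyContinuous _ _ h

/-- A Gaussian with covariance `B Bᵀ` is an affine image of the standard Gaussian. -/
theorem multivariateGaussian_mul_transpose {ι κ : Type*} [Fintype ι] [DecidableEq ι] [Fintype κ]
    [DecidableEq κ] (μ : EuclideanSpace ℝ ι) (B : Matrix ι κ ℝ) :
    multivariateGaussian μ (B * Bᵀ) =
      (stdGaussian (EuclideanSpace ℝ κ)).map (fun u => μ + Matrix.toEuclideanLin B u) := by
  have hB : Measurable (Matrix.toEuclideanLin B) :=
    (Matrix.toEuclideanLin B).continuous_of_finiteDimensional.measurable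
  have hS : (B * Bᵀ).PosSemidef := by
    simpa using Matrix.posSemidef_self_mul_conjTranspose B
  have : IsProbabilityMeasure ((stdGaussian (EuclideanSpace ℝ κ)).map
      (fun u => μ + Matrix.toEuclideanLin B u)) :=
    Measure.isProbabilityMeasure_map (by fun_prop)
  apply Measure.ext_of_charFun
  ext t
  rw [charFun_multivariateGaussian hS, charFun_apply, integral_map (by fun_prop) (by fun_prop)]
  have h : ∀ u : EuclideanSpace ℝ κ, inner ℝ (μ + Matrix.toEuclideanLin B u) t =
      inner ℝ t μ + inner ℝ u (Matrix.toEuclideanLin Bᵀ t) := by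
    intro u
    rw [inner_add_left, real_inner_comm]
    congr 1
    rw [← Matrix.conjTranspose_eq_transpose_of_trivial,
      Matrix.toEuclideanLin_conjTranspose_eq_adjoint, LinearMap.adjoint_inner_right]
  simp_rw [h]
  push_cast
  simp_rw [add_mul, Complex.exp_add]
  rw [integral_const_mul, ← charFun_apply, charFun_stdGaussian, ← Complex.exp_add]
  congr 1
  have h2 : ‖Matrix.toEuclideanLin Bᵀ t‖ ^ 2 = t.ofLp ⬝ᵥ (B * Bᵀ) *ᵥ t.ofLp := by
    rw [EuclideanSpace.real_norm_sq_eq, ← Matrix.mulVec_mulVec, Matrix.dotProduct_mulVec,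
      ← Matrix.mulVec_transpose]
    simp [dotProduct, sq, Matrix.toLpLin_apply]
  rw [← h2]
  push_cast
  ring

/-! ### Bayes classification of two Gaussian translates -/

/-- Twice the error of `g` when the two classes are standard Gaussians centred at `θ`, `-θ`. -/
noncomputable def translateError {ι : Type*} [Fintype ι] (θ : EuclideanSpace ℝ ι)
    (g : EuclideanSpace ℝ ι → SignType) : ℝ≥0∞ :=
  stdGaussian (EuclideanSpace ℝ ι) {u | g (u + θ) ≠ 1} +
    stdGaussian (EuclideanSpace ℝ ι) {u | g (u - θ) ≠ -1}

/-- The pointwise contribution of the prediction `s` to `translateError`. -/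
noncomputable def pointError {ι : Type*} [Fintype ι] (θ : EuclideanSpace ℝ ι)
    (s : SignType) (x : EuclideanSpace ℝ ι) : ℝ≥0∞ :=
  (if s ≠ 1 then ENNReal.ofReal (Real.exp (inner ℝ θ x - ‖θ‖ ^ 2 / 2)) else 0) +
    if s ≠ -1 then ENNReal.ofReal (Real.exp (-inner ℝ θ x - ‖θ‖ ^ 2 / 2)) else 0

/-- The sign pays only the smaller of the two densities. Ties are excluded because there the sign is
`0`, which pays both. -/
theorem pointError_sign_le {ι : Type*} [Fintype ι] (θ x : EuclideanSpace ℝ ι) (s : SignType)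
    (hx : inner ℝ θ x ≠ 0) :
    pointError θ (SignType.sign (inner ℝ θ x)) x ≤ pointError θ s x := by
  unfold pointError
  rcases lt_or_gt_of_ne hx with h | h
  · rw [sign_neg h]
    cases s
    · simp
    · simp
    · simpa using ENNReal.ofReal_le_ofReal (Real.exp_le_exp.2 (by linarith))
  · rw [sign_pos h]
    cases s
    · simp
    · simpa using ENNReal.ofReal_le_ofReal (Real.exp_le_exp.2 (by linarith))
    · simp

/-- Off the hyperplane the two densities differ and are positive, so the opposite label and the
label `0` both cost strictly more. -/
theorem eq_sign_of_pointError_eq {ι : Type*} [Fintype ι] (θ x : EuclideanSpace ℝ ι)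
    (s : SignType) (hx : inner ℝ θ x ≠ 0)
    (h : pointError θ (SignType.sign (inner ℝ θ x)) x = pointError θ s x) :
    s = SignType.sign (inner ℝ θ x) := by
  have hlt : ∀ a b : ℝ, a < b →
      ENNReal.ofReal (Real.exp a) < ENNReal.ofReal (Real.exp b) := fun a b hab =>
    (ENNReal.ofReal_lt_ofReal_iff (Real.exp_pos _)).2 (Real.exp_lt_exp.2 hab)
  have hpos : ∀ a : ℝ, ENNReal.ofReal (Real.exp a) ≠ 0 := fun a => by
    simpa using Real.exp_pos a
  unfold pointError at h
  rcases lt_or_gt_of_ne hx with h1 | h1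
  · rw [sign_neg h1] at h ⊢
    cases s
    · have h2 := ENNReal.lt_add_right (ENNReal.ofReal_ne_top
        (r := Real.exp (inner ℝ θ x - ‖θ‖ ^ 2 / 2))) (hpos (-inner ℝ θ x - ‖θ‖ ^ 2 / 2))
      exact absurd h (by simpa using h2.ne)
    · rfl
    · exact absurd h (by simpa using (hlt _ _ (by linarith)).ne)
  · rw [sign_pos h1] at h ⊢
    cases s
    · have h2 := ENNReal.lt_add_right (ENNReal.ofReal_ne_top
        (r := Real.exp (-inner ℝ θ x - ‖θ‖ ^ 2 / 2))) (hpos (inner ℝ θ x - ‖θ‖ ^ 2 / 2))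
      rw [add_comm] at h2
      exact absurd h (by simpa using h2.ne)
    · exact absurd h (by simpa using (hlt _ _ (by linarith)).ne)
    · rfl

theorem measurableSet_ne {α : Type*} [MeasurableSpace α] {f : α → SignType} (hf : Measurable f)
    (s : SignType) : MeasurableSet {x | f x ≠ s} :=
  (hf (MeasurableSpace.measurableSet_top (s := {s}))).compl

theorem measurable_pointError {ι : Type*} [Fintype ι] (θ : EuclideanSpace ℝ ι)
    {g : EuclideanSpace ℝ ι → SignType} (hg : Measurable g) :
    Measurable fun x => pointError θ (g x) x := by
  have h := measurableSet_ne hg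
  exact ((by fun_prop : Measurable _).ite (h 1) measurable_const).add
    ((by fun_prop : Measurable _).ite (h (-1)) measurable_const)

/-- Cameron-Martin moves both translates onto one reference measure, so the error can be minimized
pointwise. -/
theorem translateError_eq_lintegral {ι : Type*} [Fintype ι] (θ : EuclideanSpace ℝ ι)
    {g : EuclideanSpace ℝ ι → SignType} (hg : Measurable g) :
    translateError θ g =
      ∫⁻ x, pointError θ (g x) x ∂stdGaussian (EuclideanSpace ℝ ι) := by
  have h := measurableSet_ne hg
  have key : ∀ (η : EuclideanSpace ℝ ι) (s : SignType),
      stdGaussian (EuclideanSpace ℝ ι) {u | g (u + η) ≠ s} =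
        ∫⁻ x, (if g x ≠ s then ENNReal.ofReal (Real.exp (inner ℝ η x - ‖η‖ ^ 2 / 2)) else 0)
          ∂stdGaussian (EuclideanSpace ℝ ι) := by
    intro η s
    have h1 := Measure.map_apply (μ := stdGaussian (EuclideanSpace ℝ ι))
      (measurable_add_const η) (h s)
    rw [stdGaussian_map_add, withDensity_apply _ (h s), ← lintegral_indicator (h s)] at h1
    refine Eq.trans ?_ (h1.symm.trans (lintegral_congr fun x => ?_))
    · rfl
    · simp only [Set.indicator_apply, Set.mem_ofPred_eq]
  unfold translateError pointError
  rw [lintegral_add_left ((by fun_prop : Measurable _).ite (h 1) measurable_const), key θ 1]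
  congr 1
  simpa [sub_eq_add_neg] using key (-θ) (-1)

theorem measurable_sign_inner {ι : Type*} [Fintype ι] (θ : EuclideanSpace ℝ ι) :
    Measurable fun x : EuclideanSpace ℝ ι => SignType.sign (inner ℝ θ x) := by
  have h : Measurable (SignType.sign : ℝ → SignType) := by
    refine measurable_to_countable' fun s => ?_
    cases s
    · convert measurableSet_singleton (0 : ℝ)
      ext; simp
    · convert measurableSet_Iio (a := (0 : ℝ))
      ext; simp [sign_eq_neg_one_iff]
    · convert measurableSet_Ioi (a := (0 : ℝ))
      ext; simp [sign_eq_one_iff]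
  exact h.comp (by fun_prop)

/-- The sign of `⟪θ, x⟫` is a Bayes classifier for the two translates. -/
theorem translateError_sign_le {ι : Type*} [Fintype ι] {θ : EuclideanSpace ℝ ι} (hθ : θ ≠ 0)
    {g : EuclideanSpace ℝ ι → SignType} (hg : Measurable g) :
    translateError θ (fun x => SignType.sign (inner ℝ θ x)) ≤ translateError θ g := by
  rw [translateError_eq_lintegral θ hg, translateError_eq_lintegral θ (measurable_sign_inner θ)]
  refine lintegral_mono_ae ?_
  filter_upwards [stdGaussian_inner_eq_zero hθ] with x hx using pointError_sign_le θ x _ hx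

/-- Every Bayes classifier for the two translates is almost everywhere the sign of `⟪θ, x⟫`. -/
theorem ae_eq_sign_of_translateError_le {ι : Type*} [Fintype ι] {θ : EuclideanSpace ℝ ι}
    (hθ : θ ≠ 0) {g : EuclideanSpace ℝ ι → SignType} (hg : Measurable g)
    (h : translateError θ g ≤ translateError θ (fun x => SignType.sign (inner ℝ θ x))) :
    ∀ᵐ x ∂stdGaussian (EuclideanSpace ℝ ι), g x = SignType.sign (inner ℝ θ x) := by
  have hfin : translateError θ (fun x => SignType.sign (inner ℝ θ x)) ≠ ∞ := by
    unfold translateError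
    exact ENNReal.add_ne_top.2 ⟨measure_ne_top _ _, measure_ne_top _ _⟩
  rw [translateError_eq_lintegral θ hg] at h
  rw [translateError_eq_lintegral θ (measurable_sign_inner θ)] at h hfin
  have := ae_eq_of_ae_le_of_lintegral_le ?_ hfin (measurable_pointError θ hg).aemeasurable h
  · filter_upwards [this, stdGaussian_inner_eq_zero hθ] with x h1 hx
    exact eq_sign_of_pointError_eq θ x _ hx h1
  · filter_upwards [stdGaussian_inner_eq_zero hθ] with x hx using pointError_sign_le θ x _ hx

/-! ### The projection problem -/

theorem invMul_apply {r : ℕ} {lam : Fin r → ℝ} (hl : ∀ i, lam i ≠ 0)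
    (v : EuclideanSpace ℝ (Fin r)) (i : Fin r) : invMul lam v i = v i / lam i := by
  have : IsUnit lam := Pi.isUnit_iff.2 fun i => (hl i).isUnit
  obtain ⟨u, rfl⟩ := this
  simp [invMul, Matrix.inv_diagonal, Matrix.mulVec_diagonal]
  field_simp

theorem inner_invMul {r : ℕ} {lam : Fin r → ℝ} (hl : ∀ i, lam i ≠ 0)
    (v v' : EuclideanSpace ℝ (Fin r)) :
    inner ℝ v (invMul lam v') = ∑ i, v i * v' i / lam i := by
  simp only [PiLp.inner_apply, RCLike.inner_apply, conj_trivial, invMul_apply hl]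
  exact Finset.sum_congr rfl fun i _ => by ring

/-- First-order condition for the projection problem. -/
theorem IsProjSolution.inner_le {r : ℕ} {lam : Fin r → ℝ} (hl : ∀ i, 0 < lam i) {ε : ℝ}
    {m z : EuclideanSpace ℝ (Fin r)} (hz : IsProjSolution lam ε m z)
    {z' : EuclideanSpace ℝ (Fin r)} (hz' : ‖z'‖ ≤ ε) :
    inner ℝ (z' - z) (invMul lam (m - z)) ≤ 0 := by
  have hne : ∀ i, lam i ≠ 0 := fun i => (hl i).ne'
  set a := inner ℝ (z' - z) (invMul lam (m - z)) with ha
  set q := inner ℝ (z' - z) (invMul lam (z' - z)) with hq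
  have hq0 : 0 ≤ q := by
    rw [hq, inner_invMul hne]
    exact Finset.sum_nonneg fun i _ => div_nonneg (mul_self_nonneg _) (hl i).le
  -- Minimality of `z` against the points of the segment from `z` to `z'`.
  have key : ∀ t : ℝ, 0 ≤ t → t ≤ 1 → 2 * t * a ≤ t ^ 2 * q := by
    intro t ht0 ht1
    have hn : ‖(1 - t) • z + t • z'‖ ≤ ε := by
      have := (convex_closedBall (0 : EuclideanSpace ℝ (Fin r)) ε) (x := z) (by simpa using hz.1)
        (y := z') (by simpa using hz') (a := 1 - t) (b := t) (by linarith) ht0 (by ring)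
      simpa using this
    have h := hz.2 _ hn
    have e : inner ℝ (m - ((1 - t) • z + t • z')) (invMul lam (m - ((1 - t) • z + t • z'))) =
        inner ℝ (m - z) (invMul lam (m - z)) - 2 * t * a + t ^ 2 * q := by
      rw [ha, hq, inner_invMul hne, inner_invMul hne, inner_invMul hne, inner_invMul hne,
        Finset.mul_sum, Finset.mul_sum, ← Finset.sum_sub_distrib, ← Finset.sum_add_distrib]
      refine Finset.sum_congr rfl fun i _ => ?_
      simp only [PiLp.sub_apply, PiLp.add_apply, PiLp.smul_apply, smul_eq_mul]
      ring
    linarith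
  by_contra! hpos
  have h1 : 0 < q + a := by linarith
  -- If `a > 0`, this `t` lies in `(0, 1]` even when `q = 0`, and `t * q ≤ a` contradicts `2 * a ≤ t
  -- * q`.
  have h := key (a / (q + a)) (by positivity) ((div_le_one h1).2 (by linarith))
  have h2 : 0 < a / (q + a) := by positivity
  have h3 : 2 * a ≤ a / (q + a) * q := by
    by_contra! h4
    nlinarith
  have h5 : a / (q + a) * q ≤ a := by
    rw [div_mul_eq_mul_div, div_le_iff₀ h1]
    nlinarith
  linarith

/-- The first-order condition is tested at `(ε / ‖w‖) • w`, where `⟪·, w⟫` is largest on the ball.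
-/
theorem IsProjSolution.mul_norm_le {r : ℕ} {lam : Fin r → ℝ} (hl : ∀ i, 0 < lam i) {ε : ℝ}
    (hε : 0 ≤ ε) {m z : EuclideanSpace ℝ (Fin r)} (hz : IsProjSolution lam ε m z) :
    ε * ‖invMul lam (m - z)‖ ≤ inner ℝ z (invMul lam (m - z)) := by
  set w := invMul lam (m - z) with hw
  rcases eq_or_ne w 0 with h0 | h0
  · simp [h0]
  have hn : ‖w‖ ≠ 0 := by simpa using h0
  have h := hz.inner_le hl (z' := (ε / ‖w‖) • w) (by
    rw [norm_smul, norm_div, norm_norm, Real.norm_of_nonneg hε, div_mul_cancel₀ _ hn])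
  rw [← hw, inner_sub_left, real_inner_smul_left, real_inner_self_eq_norm_sq] at h
  have : ε / ‖w‖ * ‖w‖ ^ 2 = ε * ‖w‖ := by field_simp
  linarith

/-- Existence is compactness of the ball. For uniqueness, the first-order conditions of two
minimizers add up to `⟪y - z, Λ⁻¹ (y - z)⟫ ≤ 0`. -/
theorem existsUnique_isProjSolution {r : ℕ} {lam : Fin r → ℝ} (hl : ∀ i, 0 < lam i) {ε : ℝ}
    (hε : 0 ≤ ε) (m : EuclideanSpace ℝ (Fin r)) : ∃! z, IsProjSolution lam ε m z := by
  have hne : ∀ i, lam i ≠ 0 := fun i => (hl i).ne'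
  have hc : Continuous fun z : EuclideanSpace ℝ (Fin r) =>
      inner ℝ (m - z) (invMul lam (m - z)) := by
    simp_rw [inner_invMul hne]
    fun_prop
  obtain ⟨z, hz, hmin⟩ := (isCompact_closedBall (0 : EuclideanSpace ℝ (Fin r)) ε).exists_isMinOn
    ⟨0, by simpa using hε⟩ hc.continuousOn
  have hzs : IsProjSolution lam ε m z :=
    ⟨by simpa using hz, fun z' hz' => hmin (by simpa using hz')⟩
  refine ⟨z, hzs, fun y hy => ?_⟩
  have h1 := hzs.inner_le hl hy.1
  have h2 := hy.inner_le hl hzs.1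
  rw [inner_invMul hne] at h1 h2
  have h3 : ∑ i, (y i - z i) ^ 2 / lam i ≤ 0 := by
    refine le_trans (le_of_eq ?_) (add_nonpos h1 h2)
    rw [← Finset.sum_add_distrib]
    refine Finset.sum_congr rfl fun i _ => ?_
    simp only [PiLp.sub_apply]
    ring
  have h4 : ∀ i ∈ Finset.univ, 0 ≤ (y i - z i) ^ 2 / lam i := fun i _ =>
    div_nonneg (sq_nonneg _) (hl i).le
  have h5 := (Finset.sum_eq_zero_iff_of_nonneg h4).1 (le_antisymm h3 (Finset.sum_nonneg h4))
  ext i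
  have h6 := h5 i (Finset.mem_univ i)
  rw [div_eq_zero_iff, or_iff_left (hne i), sq_eq_zero_iff] at h6
  linarith

/-! ### Robust error against translate error -/

/-- The set `s` is arbitrary, as the robust error event need not be Borel; `x ↦ (x, t)` is a
measurable embedding, so the pushforward formula still applies. -/
theorem gaussianMixture_apply {d : ℕ} (μ₁ μ₂ : EuclideanSpace ℝ (Fin d))
    (S : Matrix (Fin d) (Fin d) ℝ) (s : Set (EuclideanSpace ℝ (Fin d) × SignType)) :
    gaussianMixture μ₁ μ₂ S s =
      (1 / 2 : ℝ≥0∞) * (multivariateGaussian μ₁ S {x | (x, 1) ∈ s} +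
        multivariateGaussian μ₂ S {x | (x, -1) ∈ s}) := by
  have : MeasurableSingletonClass SignType := ⟨fun _ => MeasurableSpace.measurableSet_top⟩
  have h : ∀ t : SignType,
      MeasurableEmbedding fun x : EuclideanSpace ℝ (Fin d) => (x, t) := fun t =>
    measurableEmbedding_prod_mk_right t
  rw [gaussianMixture, Measure.add_apply, Measure.smul_apply, Measure.smul_apply,
    (h 1).map_apply, (h (-1)).map_apply, mul_add]
  rfl

theorem measurable_toEuclideanLin {d r : ℕ} (B : Matrix (Fin d) (Fin r) ℝ) :
    Measurable (Matrix.toEuclideanLin B) :=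
  (Matrix.toEuclideanLin B).continuous_of_finiteDimensional.measurable

/-- `f` treats the class means `μ₁`, `μ₂` as if they were `m + p`, `m - p`. -/
def SeesMeans {d : ℕ} (μ₁ μ₂ m p : EuclideanSpace ℝ (Fin d))
    (f : EuclideanSpace ℝ (Fin d) → SignType) : Prop :=
  ∀ y, f (μ₁ + y) = f (m + (p + y)) ∧ f (μ₂ + y) = f (m + (-p + y))

/-- The adversary plays the fixed shifts `-B c` on class `1` and `B c` on class `-1`. -/
theorem translateError_le_robustError {d r : ℕ} {μ₁ μ₂ m : EuclideanSpace ℝ (Fin d)}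
    {B : Matrix (Fin d) (Fin r) ℝ} {b c : EuclideanSpace ℝ (Fin r)} {ε : ℝ}
    (hc : ‖Matrix.toEuclideanLin B c‖ ≤ ε) {f : EuclideanSpace ℝ (Fin d) → SignType}
    (hf : SeesMeans μ₁ μ₂ m (Matrix.toEuclideanLin B b) f) :
    1 / 2 * translateError (b - c) (fun u => f (m + Matrix.toEuclideanLin B u)) ≤
      robustError ε (gaussianMixture μ₁ μ₂ (B * Bᵀ)) f := by
  have hB := measurable_toEuclideanLin B
  rw [robustError, gaussianMixture_apply, translateError, multivariateGaussian_mul_transpose,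
    multivariateGaussian_mul_transpose]
  gcongr
  · refine (measure_mono fun u hu => ?_).trans (Measure.le_map_apply (by fun_prop) _)
    refine ⟨-Matrix.toEuclideanLin B c, by rwa [norm_neg], ?_⟩
    rw [add_assoc, (hf _).1]
    convert hu using 3
    rw [map_add, map_sub]
    abel_nf
  · refine (measure_mono fun u hu => ?_).trans (Measure.le_map_apply (by fun_prop) _)
    refine ⟨Matrix.toEuclideanLin B c, hc, ?_⟩
    rw [add_assoc, (hf _).2]
    convert hu using 3
    rw [map_sub, map_sub]
    abel_nf

/-- By Cauchy-Schwarz and `hc`, no admissible `δ` changes `⟪x, v⟫` by more than `⟪B c, v⟫`, so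
surviving the shift `∓B c` means surviving every attack. -/
theorem robustError_sign_le {d r : ℕ} {μ₁ μ₂ m v : EuclideanSpace ℝ (Fin d)}
    {B : Matrix (Fin d) (Fin r) ℝ} {b c : EuclideanSpace ℝ (Fin r)} {ε : ℝ}
    (hc : ε * ‖v‖ ≤ inner ℝ (Matrix.toEuclideanLin B c) v)
    (hv : ∀ u, inner ℝ (Matrix.toEuclideanLin B u) v = inner ℝ (b - c) u)
    (hf : SeesMeans μ₁ μ₂ m (Matrix.toEuclideanLin B b)
      (fun x => SignType.sign (inner ℝ (x - m) v))) :
    robustError ε (gaussianMixture μ₁ μ₂ (B * Bᵀ))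
        (fun x => SignType.sign (inner ℝ (x - m) v)) ≤
      1 / 2 * translateError (b - c) (fun u => SignType.sign (inner ℝ (b - c) u)) := by
  have hB := measurable_toEuclideanLin B
  set f : EuclideanSpace ℝ (Fin d) → SignType := fun x => SignType.sign (inner ℝ (x - m) v)
    with hfdef
  have hfm : Measurable f := by
    have h : f = (fun x => SignType.sign (inner ℝ v x)) ∘ fun x => x - m := by
      ext x; simp [hfdef, real_inner_comm]
    rw [h]
    exact (measurable_sign_inner v).comp (by fun_prop)
  have hu : ∀ u, f (m + Matrix.toEuclideanLin B u) = SignType.sign (inner ℝ (b - c) u) := by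
    intro u
    simp [hfdef, hv]
  have hd : ∀ δ : EuclideanSpace ℝ (Fin d), ‖δ‖ ≤ ε → |inner ℝ δ v| ≤ ε * ‖v‖ := fun δ hδ =>
    (abs_real_inner_le_norm _ _).trans (by gcongr)
  rw [robustError, gaussianMixture_apply, translateError]
  gcongr 1 / 2 * (?_ + ?_)
  · calc _ ≤ multivariateGaussian μ₁ (B * Bᵀ)
          {x | f (x - Matrix.toEuclideanLin B c) ≠ 1} := by
          refine measure_mono ?_
          rintro x ⟨δ, hδ, hx⟩ h
          refine hx ?_
          simp only [hfdef, sign_eq_one_iff, inner_sub_left, inner_add_left] at h ⊢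
          linarith [neg_le_of_abs_le (hd δ hδ)]
      _ = _ := by
          rw [multivariateGaussian_mul_transpose, Measure.map_apply (by fun_prop)
            (measurableSet_ne
            (f := fun x => f (x - Matrix.toEuclideanLin B c)) (hfm.comp (by fun_prop)) 1)]
          congr 1
          ext u
          simp only [Set.mem_preimage, Set.mem_ofPred_eq]
          rw [← hu, add_sub_assoc, (hf _).1, map_add, map_sub]
          abel_nf
  · calc _ ≤ multivariateGaussian μ₂ (B * Bᵀ)
          {x | f (x + Matrix.toEuclideanLin B c) ≠ -1} := by
          refine measure_mono ?_
          rintro x ⟨δ, hδ, hx⟩ h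
          refine hx ?_
          simp only [hfdef, sign_eq_neg_one_iff, inner_sub_left, inner_add_left] at h ⊢
          linarith [le_of_abs_le (hd δ hδ)]
      _ = _ := by
          rw [multivariateGaussian_mul_transpose, Measure.map_apply (by fun_prop)
            (measurableSet_ne
            (f := fun x => f (x + Matrix.toEuclideanLin B c)) (hfm.comp (by fun_prop)) (-1))]
          congr 1
          ext u
          simp only [Set.mem_preimage, Set.mem_ofPred_eq]
          rw [← hu, add_assoc, (hf _).2, map_sub, map_sub]
          abel_nf

/-! ### Standard accuracy of an optimal classifier -/

theorem Phi_div_norm {ι : Type*} [Fintype ι] {θ : EuclideanSpace ℝ ι} (hθ : θ ≠ 0) (κ : ℝ) :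
    (stdGaussian (EuclideanSpace ℝ ι)).real {u | inner ℝ θ u < κ} = Phi (κ / ‖θ‖) := by
  have hn : 0 < ‖θ‖ := norm_pos_iff.2 hθ
  have h1 : gaussianReal 0 (‖θ‖₊ ^ 2) = (gaussianReal 0 1).map (fun x => ‖θ‖ * x) := by
    rw [gaussianReal_map_const_mul]
    congr 1
    · simp
    · ext; simp
  have := nullSingletonClass_gaussianReal (μ := 0) (one_ne_zero : (1 : NNReal) ≠ 0)
  rw [Phi, cdf_eq_real, ← measureReal_congr (Iio_ae_eq_Iic (a := κ / ‖θ‖)), measureReal_def,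
    measureReal_def]
  congr 1
  have h2 : (stdGaussian (EuclideanSpace ℝ ι)) {u | inner ℝ θ u < κ} =
      (stdGaussian (EuclideanSpace ℝ ι)).map (fun x => inner ℝ θ x) (Set.Iio κ) := by
    rw [Measure.map_apply (by fun_prop) measurableSet_Iio]
    rfl
  rw [h2, stdGaussian_map_inner, h1, Measure.map_apply (by fun_prop) measurableSet_Iio]
  congr 1
  ext x
  rw [Set.mem_preimage, Set.mem_Iio, Set.mem_Iio, lt_div_iff₀ hn, mul_comm]

theorem Phi_div_norm_neg {ι : Type*} [Fintype ι] {θ : EuclideanSpace ℝ ι} (hθ : θ ≠ 0) (κ : ℝ) :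
    (stdGaussian (EuclideanSpace ℝ ι)).real {u | -κ < inner ℝ θ u} = Phi (κ / ‖θ‖) := by
  rw [← norm_neg θ, ← Phi_div_norm (neg_ne_zero.2 hθ)]
  congr 1
  ext u
  simp [neg_lt]

/-- The hypothesis `hs` concerns centred `u`; absolute continuity of translates carries it to the
class centres `±b`, where both classes give the same `Φ` value. -/
theorem standardAccuracy_eq {d r : ℕ} {μ₁ μ₂ m : EuclideanSpace ℝ (Fin d)}
    {B : Matrix (Fin d) (Fin r) ℝ} {b θ : EuclideanSpace ℝ (Fin r)} (hθ : θ ≠ 0)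
    {f : EuclideanSpace ℝ (Fin d) → SignType} (hfm : Measurable f)
    (hf : SeesMeans μ₁ μ₂ m (Matrix.toEuclideanLin B b) f)
    (hs : ∀ᵐ u ∂stdGaussian (EuclideanSpace ℝ (Fin r)),
      f (m + Matrix.toEuclideanLin B u) = SignType.sign (inner ℝ θ u)) :
    standardAccuracy (gaussianMixture μ₁ μ₂ (B * Bᵀ)) f = Phi (inner ℝ θ b / ‖θ‖) := by
  have hB := measurable_toEuclideanLin B
  have hm : ∀ s : SignType, MeasurableSet {x | f x = s} := fun s =>
    hfm (MeasurableSpace.measurableSet_top (s := {s}))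
  have h1 : multivariateGaussian μ₁ (B * Bᵀ) {x | f x = 1} =
      stdGaussian (EuclideanSpace ℝ (Fin r)) {u | -inner ℝ θ b < inner ℝ θ u} := by
    rw [multivariateGaussian_mul_transpose, Measure.map_apply (by fun_prop) (hm 1)]
    refine measure_congr ?_
    filter_upwards [ae_stdGaussian_comp_add b hs] with u hu
    refine propext ?_
    change f (μ₁ + _) = 1 ↔ _ < _
    rw [(hf _).1, ← map_add, add_comm b, hu, sign_eq_one_iff, inner_add_right, neg_lt_iff_pos_add]
  have h2 : multivariateGaussian μ₂ (B * Bᵀ) {x | f x = -1} =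
      stdGaussian (EuclideanSpace ℝ (Fin r)) {u | inner ℝ θ u < inner ℝ θ b} := by
    rw [multivariateGaussian_mul_transpose, Measure.map_apply (by fun_prop) (hm (-1))]
    refine measure_congr ?_
    filter_upwards [ae_stdGaussian_comp_add (-b) hs] with u hu
    refine propext ?_
    change f (μ₂ + _) = -1 ↔ _ < _
    rw [(hf _).2, ← map_neg, ← map_add, add_comm (-b), hu, sign_eq_neg_one_iff, inner_add_right,
      inner_neg_right]
    constructor <;> intro h <;> linarith
  rw [standardAccuracy, measureReal_def, gaussianMixture_apply]
  simp only [Set.mem_ofPred_eq]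
  rw [h1, h2, ENNReal.toReal_mul, ENNReal.toReal_add (measure_ne_top _ _) (measure_ne_top _ _),
    ← measureReal_def, ← measureReal_def, Phi_div_norm hθ, Phi_div_norm_neg hθ]
  simp
  ring

/-- The linear classifier is robust Bayes optimal in every class of measurable classifiers that
only see the component of the means in the range of `B`, and the optimal accuracy is unique. -/
theorem isRobustBayesOptimal_sign {d r : ℕ} {μ₁ μ₂ m v : EuclideanSpace ℝ (Fin d)}
    {B : Matrix (Fin d) (Fin r) ℝ} {b c : EuclideanSpace ℝ (Fin r)} {ε : ℝ} (hbc : b - c ≠ 0)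
    (hcε : ‖Matrix.toEuclideanLin B c‖ ≤ ε)
    (hc : ε * ‖v‖ ≤ inner ℝ (Matrix.toEuclideanLin B c) v)
    (hv : ∀ u, inner ℝ (Matrix.toEuclideanLin B u) v = inner ℝ (b - c) u)
    {C : Set (EuclideanSpace ℝ (Fin d) → SignType)}
    (hC : ∀ f ∈ C, Measurable f ∧ SeesMeans μ₁ μ₂ m (Matrix.toEuclideanLin B b) f)
    (hmem : (fun x => SignType.sign (inner ℝ (x - m) v)) ∈ C) :
    IsRobustBayesOptimal C ε (gaussianMixture μ₁ μ₂ (B * Bᵀ))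
        (fun x => SignType.sign (inner ℝ (x - m) v)) ∧
      ∀ f, IsRobustBayesOptimal C ε (gaussianMixture μ₁ μ₂ (B * Bᵀ)) f →
        standardAccuracy (gaussianMixture μ₁ μ₂ (B * Bᵀ)) f =
          Phi (inner ℝ (b - c) b / ‖b - c‖) := by
  have hB := measurable_toEuclideanLin B
  have hup := robustError_sign_le hc hv (hC _ hmem).2
  have hm : ∀ f ∈ C, Measurable fun u => f (m + Matrix.toEuclideanLin B u) := fun f hf =>
    (hC f hf).1.comp (by fun_prop)
  refine ⟨⟨hmem, fun g hg => hup.trans (le_trans ?_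
    (translateError_le_robustError hcε (hC g hg).2))⟩, fun f hf => ?_⟩
  · gcongr
    exact translateError_sign_le hbc (hm g hg)
  · refine standardAccuracy_eq hbc (hC f hf.1).1 (hC f hf.1).2
      (ae_eq_sign_of_translateError_le hbc (hm f hf.1) ?_)
    -- Optimality of `f` closes the chain of bounds.
    have h := (translateError_le_robustError hcε (hC f hf.1).2).trans
      ((hf.2 _ hmem).trans hup)
    exact (ENNReal.mul_le_mul_iff_right (by simp) (by simp)).1 h

/-! ### The thin eigendecomposition and the map `Fᵀ` -/

theorem IsThinEigendecomposition.pos {d r : ℕ} {S : Matrix (Fin d) (Fin d) ℝ}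
    {F : Matrix (Fin d) (Fin r) ℝ} {lam : Fin r → ℝ} (hF : IsThinEigendecomposition S F lam)
    (hS : S.PosSemidef) (i : Fin r) : 0 < lam i := by
  have h : (Matrix.diagonal lam).PosSemidef := by
    have h1 := hS.conjTranspose_mul_mul_same F
    rw [← hF.eq, Matrix.conjTranspose_eq_transpose_of_trivial] at h1
    have h2 : Fᵀ * (F * Matrix.diagonal lam * Fᵀ) * F = Matrix.diagonal lam := by
      calc _ = (Fᵀ * F) * Matrix.diagonal lam * (Fᵀ * F) := by simp only [Matrix.mul_assoc]
        _ = _ := by rw [hF.orthonormal, Matrix.one_mul, Matrix.mul_one]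
    rwa [h2] at h1
  exact lt_of_le_of_ne (Matrix.posSemidef_diagonal_iff.1 h i) (hF.ne_zero i).symm

theorem inner_toEuclideanLin {d r : ℕ} (F : Matrix (Fin d) (Fin r) ℝ)
    (u : EuclideanSpace ℝ (Fin r)) (x : EuclideanSpace ℝ (Fin d)) :
    inner ℝ (Matrix.toEuclideanLin F u) x = inner ℝ u (reduce F x) := by
  change _ = inner ℝ u (Matrix.toEuclideanLin Fᵀ x)
  rw [← Matrix.conjTranspose_eq_transpose_of_trivial,
    Matrix.toEuclideanLin_conjTranspose_eq_adjoint, LinearMap.adjoint_inner_right]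

theorem reduce_toEuclideanLin {d r : ℕ} {F : Matrix (Fin d) (Fin r) ℝ} (hF : Fᵀ * F = 1)
    (u : EuclideanSpace ℝ (Fin r)) : reduce F (Matrix.toEuclideanLin F u) = u := by
  simp [reduce, Matrix.toLpLin_apply, hF]

theorem reduce_add {d r : ℕ} (F : Matrix (Fin d) (Fin r) ℝ) (x y : EuclideanSpace ℝ (Fin d)) :
    reduce F (x + y) = reduce F x + reduce F y :=
  map_add (Matrix.toEuclideanLin Fᵀ) x y

theorem measurable_reduce {d r : ℕ} (F : Matrix (Fin d) (Fin r) ℝ) : Measurable (reduce F) :=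
  measurable_toEuclideanLin Fᵀ

theorem linearClassifier_eq {d r : ℕ} (F : Matrix (Fin d) (Fin r) ℝ)
    (μ₁ μ₂ : EuclideanSpace ℝ (Fin d)) (w : EuclideanSpace ℝ (Fin r)) :
    linearClassifier F μ₁ μ₂ w = fun x => SignType.sign
      (inner ℝ (x - (1 / 2 : ℝ) • (μ₁ + μ₂)) (Matrix.toEuclideanLin F w)) := rfl

theorem linearClassifier_mem_reducedClassifiers {d r : ℕ} (F : Matrix (Fin d) (Fin r) ℝ)
    (μ₁ μ₂ : EuclideanSpace ℝ (Fin d)) (w : EuclideanSpace ℝ (Fin r)) :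
    linearClassifier F μ₁ μ₂ w ∈ reducedClassifiers F := by
  refine ⟨fun u => SignType.sign (inner ℝ w (u - reduce F ((1 / 2 : ℝ) • (μ₁ + μ₂)))),
    (measurable_sign_inner w).comp (measurable_sub_const _), ?_⟩
  funext x
  rw [linearClassifier_eq]
  dsimp only
  rw [real_inner_comm, inner_toEuclideanLin]
  congr 2
  exact map_sub (Matrix.toEuclideanLin Fᵀ) _ _

theorem measurable_of_mem_reducedClassifiers {d r : ℕ} {F : Matrix (Fin d) (Fin r) ℝ}
    {f : EuclideanSpace ℝ (Fin d) → SignType} (hf : f ∈ reducedClassifiers F) :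
    Measurable f := by
  obtain ⟨h, hh, rfl⟩ := hf
  exact hh.comp (measurable_reduce F)

/-- Classifiers of `Fᵀ x` cannot see the component of the means outside the range of `F`. -/
theorem seesMeans_of_mem_reducedClassifiers {d r : ℕ} {F : Matrix (Fin d) (Fin r) ℝ}
    (hF : Fᵀ * F = 1) (μ₁ μ₂ : EuclideanSpace ℝ (Fin d))
    {f : EuclideanSpace ℝ (Fin d) → SignType} (hf : f ∈ reducedClassifiers F) :
    SeesMeans μ₁ μ₂ ((1 / 2 : ℝ) • (μ₁ + μ₂)) (Matrix.toEuclideanLin F (muTilde F μ₁ μ₂)) f := by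
  obtain ⟨h, -, rfl⟩ := hf
  have hneg : reduce F (-Matrix.toEuclideanLin F (muTilde F μ₁ μ₂)) = -muTilde F μ₁ μ₂ := by
    rw [← map_neg, reduce_toEuclideanLin hF]
  intro y
  simp only [reduce_add, reduce_toEuclideanLin hF, hneg, ← add_assoc]
  have hadd : reduce F ((1 / 2 : ℝ) • (μ₁ + μ₂)) + muTilde F μ₁ μ₂ = reduce F μ₁ := by
    rw [muTilde, ← reduce_add]
    congr 1
    module
  have hsub : reduce F ((1 / 2 : ℝ) • (μ₁ + μ₂)) + -muTilde F μ₁ μ₂ = reduce F μ₂ := by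
    have h2 : muTilde F μ₁ μ₂ + muTilde F μ₁ μ₂ + reduce F μ₂ = reduce F μ₁ := by
      rw [muTilde, ← reduce_add, ← reduce_add]
      congr 1
      module
    rw [← add_left_inj (muTilde F μ₁ μ₂ + muTilde F μ₁ μ₂), add_comm (reduce F μ₂), h2, ← hadd]
    abel
  rw [hadd, hsub]
  exact ⟨rfl, rfl⟩

/-- When the difference of the means is in the range of `S`, every classifier sees them fully. -/
theorem seesMeans_of_mem_range {d r : ℕ} {S : Matrix (Fin d) (Fin d) ℝ}
    {F : Matrix (Fin d) (Fin r) ℝ} {lam : Fin r → ℝ} (hF : IsThinEigendecomposition S F lam)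
    {μ₁ μ₂ : EuclideanSpace ℝ (Fin d)} (h : ∃ v : Fin d → ℝ, S *ᵥ v = (μ₁ - μ₂).ofLp)
    (f : EuclideanSpace ℝ (Fin d) → SignType) :
    SeesMeans μ₁ μ₂ ((1 / 2 : ℝ) • (μ₁ + μ₂)) (Matrix.toEuclideanLin F (muTilde F μ₁ μ₂)) f := by
  obtain ⟨v, hv⟩ := h
  have hr : Matrix.toEuclideanLin F (reduce F (μ₁ - μ₂)) = μ₁ - μ₂ := by
    -- The range of `S` lies in that of `F`, on which `F Fᵀ` is the identity.
    have h1 : μ₁ - μ₂ = Matrix.toEuclideanLin F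
        (WithLp.toLp 2 ((Matrix.diagonal lam * Fᵀ) *ᵥ v)) := by
      ext i
      rw [← hv, ← hF.eq]
      simp [Matrix.toLpLin_apply, Matrix.mul_assoc]
    rw [h1, reduce_toEuclideanLin hF.orthonormal]
  have hp : Matrix.toEuclideanLin F (muTilde F μ₁ μ₂) = (1 / 2 : ℝ) • (μ₁ - μ₂) := by
    conv_rhs => rw [← hr, ← map_smul]
    congr 1
    exact map_smul (Matrix.toEuclideanLin Fᵀ) _ _
  intro y
  rw [hp]
  constructor
  · congr 1
    module
  · congr 1
    module

end RobustGaussian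

/-! ### The main theorem -/

open RobustGaussian in
theorem theorem2 {d r : ℕ} (μ₁ μ₂ : EuclideanSpace ℝ (Fin d))
    (S : Matrix (Fin d) (Fin d) ℝ) (hS : S.PosSemidef)
    (F : Matrix (Fin d) (Fin r) ℝ) (lam : Fin r → ℝ) (hF : IsThinEigendecomposition S F lam)
    (ε : ℝ) (hε : 0 ≤ ε) (hεμ : ε < ‖muTilde F μ₁ μ₂‖) :
    (∃! z, IsProjSolution lam ε (muTilde F μ₁ μ₂) z) ∧
    ∀ z w : EuclideanSpace ℝ (Fin r), IsProjSolution lam ε (muTilde F μ₁ μ₂) z →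
      w = invMul lam (muTilde F μ₁ μ₂ - z) →
      0 < lamNorm lam w ∧
      -- robust Bayes optimality among all classifiers, when the two classes share their support
      ((∃ v : Fin d → ℝ, S *ᵥ v = (μ₁ - μ₂).ofLp) →
        IsRobustBayesOptimal (allClassifiers d) ε (gaussianMixture μ₁ μ₂ S)
          (linearClassifier F μ₁ μ₂ w) ∧
        ∀ f, IsRobustBayesOptimal (allClassifiers d) ε (gaussianMixture μ₁ μ₂ S) f →
          standardAccuracy (gaussianMixture μ₁ μ₂ S) f =
            Phi (inner ℝ (muTilde F μ₁ μ₂) w / lamNorm lam w)) ∧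
      -- robust Bayes optimality among the classifiers of `Fᵀ x`, for every covariance
      (IsRobustBayesOptimal (reducedClassifiers F) ε (gaussianMixture μ₁ μ₂ S)
          (linearClassifier F μ₁ μ₂ w) ∧
        ∀ f, IsRobustBayesOptimal (reducedClassifiers F) ε (gaussianMixture μ₁ μ₂ S) f →
          standardAccuracy (gaussianMixture μ₁ μ₂ S) f =
            Phi (inner ℝ (muTilde F μ₁ μ₂) w / lamNorm lam w)) := by
  have hl := hF.pos hS
  have hne : ∀ i, lam i ≠ 0 := hF.ne_zero
  have hs : ∀ i, √(lam i) ≠ 0 := fun i => (Real.sqrt_pos.2 (hl i)).ne'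
  refine ⟨existsUnique_isProjSolution hl hε _, ?_⟩
  rintro z w hz hw
  set μt := muTilde F μ₁ μ₂
  set D : Matrix (Fin r) (Fin r) ℝ := Matrix.diagonal fun i => √(lam i) with hD
  have hDa : ∀ u i, Matrix.toEuclideanLin D u i = √(lam i) * u i := fun u i => by
    simp [hD, Matrix.toLpLin_apply, Matrix.mulVec_diagonal]
  have hS' : S = F * D * (F * D)ᵀ := by
    rw [← hF.eq, Matrix.transpose_mul, hD, Matrix.diagonal_transpose, Matrix.mul_assoc,
      Matrix.mul_assoc, ← Matrix.mul_assoc (Matrix.diagonal fun i => √(lam i)), Matrix.diagonal_mul_diagonal]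
    simp_rw [Real.mul_self_sqrt (hl _).le]
  have hB : ∀ u, Matrix.toEuclideanLin (F * D) u =
      Matrix.toEuclideanLin F (Matrix.toEuclideanLin D u) := fun u => by
    simp [Matrix.toLpLin_apply]
  -- Whitened coordinates: `b = Λ^(-1/2) μ̃`, `c = Λ^(-1/2) z`. Then `b - c = Λ^(1/2) w`, whose
  -- Euclidean norm is `‖w‖_Λ`.
  let b : EuclideanSpace ℝ (Fin r) := WithLp.toLp 2 fun i => μt i / √(lam i)
  let c : EuclideanSpace ℝ (Fin r) := WithLp.toLp 2 fun i => z i / √(lam i)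
  have hb : Matrix.toEuclideanLin D b = μt := by
    ext i
    rw [hDa]
    exact mul_div_cancel₀ _ (hs i)
  have hc : Matrix.toEuclideanLin D c = z := by
    ext i
    rw [hDa]
    exact mul_div_cancel₀ _ (hs i)
  have hwi : ∀ i, w i = (μt i - z i) / lam i := fun i => by rw [hw, invMul_apply hne]; rfl
  have hbci : ∀ i, (b - c) i = √(lam i) * w i := fun i => by
    change μt i / √(lam i) - z i / √(lam i) = _
    rw [hwi, ← sub_div, div_eq_iff (hs i)]
    have := Real.mul_self_sqrt (hl i).le
    have h2 := hne i
    field_simp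
    rw [Real.sq_sqrt (hl i).le]
  -- Since `ε < ‖μ̃‖`, the point `μ̃` is not feasible, so `z ≠ μ̃`.
  have hbc : b - c ≠ 0 := by
    intro h
    have h1 : μt - z = 0 := by rw [← hb, ← hc, ← map_sub, h, map_zero]
    rw [sub_eq_zero] at h1
    exact absurd hz.1 (by rw [← h1]; exact not_le.2 hεμ)
  have hnorm : lamNorm lam w = ‖b - c‖ := by
    rw [lamNorm, EuclideanSpace.norm_eq]
    congr 1
    simp only [dotProduct, Matrix.mulVec_diagonal]
    refine Finset.sum_congr rfl fun i _ => ?_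
    rw [hbci, Real.norm_eq_abs, sq_abs, mul_pow, Real.sq_sqrt (hl i).le]
    ring
  have hinner : inner ℝ μt w = inner ℝ (b - c) b := by
    simp only [PiLp.inner_apply, RCLike.inner_apply, conj_trivial]
    refine Finset.sum_congr rfl fun i _ => ?_
    rw [hbci]
    change _ = μt i / √(lam i) * _
    field_simp [hs i]
  have hFw : ∀ u, inner ℝ (Matrix.toEuclideanLin F u) (Matrix.toEuclideanLin F w) =
      inner ℝ u w := fun u => by
    rw [inner_toEuclideanLin, reduce_toEuclideanLin hF.orthonormal]
  have hFn : ∀ u, ‖Matrix.toEuclideanLin F u‖ = ‖u‖ := fun u => by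
    rw [← sq_eq_sq₀ (norm_nonneg _) (norm_nonneg _), ← real_inner_self_eq_norm_sq,
      inner_toEuclideanLin, reduce_toEuclideanLin hF.orthonormal, real_inner_self_eq_norm_sq]
  have hcε : ‖Matrix.toEuclideanLin (F * D) c‖ ≤ ε := by
    rw [hB, hc, hFn]
    exact hz.1
  have hcw : ε * ‖Matrix.toEuclideanLin F w‖ ≤
      inner ℝ (Matrix.toEuclideanLin (F * D) c) (Matrix.toEuclideanLin F w) := by
    rw [hB, hc, hFn, hFw, hw]
    exact hz.mul_norm_le hl hε
  have hv : ∀ u, inner ℝ (Matrix.toEuclideanLin (F * D) u) (Matrix.toEuclideanLin F w) =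
      inner ℝ (b - c) u := fun u => by
    rw [hB, hFw]
    simp only [PiLp.inner_apply, RCLike.inner_apply, conj_trivial]
    refine Finset.sum_congr rfl fun i _ => ?_
    rw [hbci, hDa]
    ring
  have hp : Matrix.toEuclideanLin (F * D) b = Matrix.toEuclideanLin F μt := by rw [hB, hb]
  have hmem := linearClassifier_mem_reducedClassifiers F μ₁ μ₂ w
  rw [hnorm, hinner, hS', linearClassifier_eq]
  rw [linearClassifier_eq] at hmem
  refine ⟨norm_pos_iff.2 hbc, fun hr => ?_, ?_⟩
  · rw [← hS'] at hr
    refine isRobustBayesOptimal_sign hbc hcε hcw hv (fun f hf => ⟨hf, ?_⟩)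
      (measurable_of_mem_reducedClassifiers hmem)
    rw [hp]
    exact seesMeans_of_mem_range hF hr f
  · refine isRobustBayesOptimal_sign hbc hcε hcw hv
      (fun f hf => ⟨measurable_of_mem_reducedClassifiers hf, ?_⟩) hmem
    rw [hp]
    exact seesMeans_of_mem_reducedClassifiers hF.orthonormal μ₁ μ₂ hf
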